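/- Let $m\ge 1$ be an integer and $n=m^2$, and let $s_1,\dots,s_n$ be independent random variables, each uniformly distributed on $\{1,\dots,n\}$. Algorithm BUCKET uses $m$ initially empty buckets $B_1,\dots,B_m$ and processes $s_1,s_2,\dots,s_n$ in this order: with $r=\lceil s_i/m\rceil$, it searches for $s_i$ among the elements of $B_r$; if $s_i$ is found there (the first repetition), the algorithm stops, otherwise $s_i$ is put into $B_r$; the algorithm also stops after $s_n$ has been processed. Let $b_j$ be the number of elements in $B_j$ when the algorithm stops (at the moment of the first repetition, if there is one). Then $$\mathrm{E}\{b_j\}=\sqrt{\frac{\pi}{2}}-\mu(n)\qquad\text{for } j=1,2,\dots,m,$$ where, for every positive integer $n$, $$\mu(n)=\frac{1}{3\sqrt n}-\frac{\kappa(n)}{\sqrt n},\qquad \kappa(n)=\frac13-\sqrt{\frac{\pi n}{2}}+\sum_{k=1}^{n}\frac{n!\,k^2}{(n-k)!\,n^{k+1}}.$$ Moreover $\mu(n)$, as a function of the positive integer $n$, is strictly decreasing and tends to $0$ as $n\to\infty$. -/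

import Mathlib

namespace BucketTest

/-- The index `⌈x / m⌉` of the bucket to which the number `x` belongs. -/
def bucketIndex (m x : ℕ) : ℕ := ⌈(x : ℚ) / m⌉₊

/-- The main loop of the algorithm `BUCKET` with bucket size `m`, started with bucket contents `B`:
each input element is looked up in its own bucket `B r`; if it is found there (the first
repetition), the algorithm stops at once, otherwise the element is put at the end of that bucket.
The loop also stops when the input is exhausted. The value is the family of bucket contents at
the moment of stopping. -/
def bucketLoop (m : ℕ) : List ℕ → (ℕ → List ℕ) → (ℕ → List ℕ)
  | [], B => B
  | x :: xs, B =>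
      if x ∈ B (bucketIndex m x) then B
      else bucketLoop m xs
        (Function.update B (bucketIndex m x) (B (bucketIndex m x) ++ [x]))

/-- The number of elements in the bucket `j` when `BUCKET`, started with empty buckets on the
input `s` of length `n`, stops. -/
def bucketCount (m : ℕ) {n : ℕ} (s : Fin n → ℕ) (j : ℕ) : ℕ :=
  (bucketLoop m (List.ofFn s) (fun _ => []) j).length

/-- `κ(n) = 1/3 - √(π n / 2) + ∑_{k=1}^n n! k² / ((n - k)! n^(k+1))`. -/
noncomputable def kappa (n : ℕ) : ℝ :=
  1 / 3 - Real.sqrt (Real.pi * n / 2) +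
    ∑ k ∈ Finset.Icc 1 n,
      ((n.factorial : ℝ) * (k : ℝ) ^ 2) / (((n - k).factorial : ℝ) * (n : ℝ) ^ (k + 1))

/-- `μ(n) = 1 / (3 √n) - κ(n) / √n`. -/
noncomputable def mu (n : ℕ) : ℝ :=
  1 / (3 * Real.sqrt n) - kappa n / Real.sqrt n

end BucketTest

/-! The bucket `j` finally holds one element for each `i` such that `s₁, …, sᵢ` are distinct and
`sᵢ` belongs to bucket `j`. By symmetry of the last letter under permutations of `{1, …, n}`, this
event has probability `(m / n) * n (n - 1) ⋯ (n - i + 1) / n ^ i`, so the mean of `b_j` is `m / n`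
times Ramanujan's `Q(n)`, and summation by parts identifies `√(π / 2) - μ(n)` with `Q(n) / √n`.

Expanding `(1 + x) ^ (n - 1)` shows `Q(n) = n ∫₀^∞ (1 + x) ^ (n - 1) exp (-n x) dx`. Substituting
`t² / 2 = x - log (1 + x)` and then `t = s / √n` gives
`Q(n) / √n = ∫₀^∞ exp (-s² / 2) ρ(s / √n) ds` with `ρ(t) = t / x`. Since `ρ` decreases strictly
from its limit `1` at `0`, the right-hand side increases strictly with `n` to `√(π / 2)`.
-/

namespace BucketTest

open Filter Function MeasureTheory ProbabilityTheory Real Set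
open scoped Finset Topology

/-- Ramanujan's `Q`-function `Q(n) = ∑_{k=1}^n n! / ((n - k)! n^k)`. -/
noncomputable def ramanujanQ (n : ℕ) : ℝ :=
  ∑ k ∈ Finset.range n, (n.descFactorial (k + 1) : ℝ) / (n : ℝ) ^ (k + 1)

section Algorithm

lemma length_update_append_singleton {α κ : Type*} [DecidableEq κ] (B : κ → List α) (r j : κ)
    (x : α) :
    (update B r (B r ++ [x]) j).length = (B j).length + if r = j then 1 else 0 := by
  rcases eq_or_ne r j with rfl | h
  · simp
  · simp [h, update_of_ne h.symm]

lemma notMem_update_append_singleton_iff {α κ : Type*} [DecidableEq κ] (B : κ → List α)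
    (r : α → κ) (x y : α) :
    y ∉ update B (r x) (B (r x) ++ [x]) (r y) ↔ y ∉ B (r y) ∧ y ≠ x := by
  by_cases h : r y = r x
  · simp [h]
  · simp [update_of_ne h, ne_of_apply_ne r h]

lemma injOn_Iic_succ_iff {α : Type*} {n : ℕ} (s : Fin (n + 1) → α) (i : Fin n) :
    InjOn s (Iic i.succ) ↔
      InjOn (fun k => s k.succ) (Iic i) ∧ ∀ k ≤ i, s k.succ ≠ s 0 := by
  simp only [InjOn, mem_Iic, Fin.forall_fin_succ, Fin.zero_le, Fin.succ_le_succ_iff,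
    Fin.succ_inj, forall_const]
  grind

open scoped Classical in
lemma length_bucketLoop_ofFn (m j : ℕ) {n : ℕ} (s : Fin n → ℕ) (B : ℕ → List ℕ) :
    (bucketLoop m (List.ofFn s) B j).length = (B j).length +
      #{i | InjOn s (Iic i) ∧ (∀ k ≤ i, s k ∉ B (bucketIndex m (s k))) ∧
        bucketIndex m (s i) = j} := by
  induction n generalizing B with
  | zero => simp [bucketLoop]
  | succ n ih =>
    rw [List.ofFn_succ, bucketLoop, Fin.card_filter_univ_succ']
    by_cases hfound : s 0 ∈ B (bucketIndex m (s 0))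
    · simp [hfound, Fin.forall_fin_succ]
    · have hzero : (InjOn s (Iic 0) ∧ (∀ k ≤ 0, s k ∉ B (bucketIndex m (s k))) ∧
          bucketIndex m (s 0) = j) ↔ bucketIndex m (s 0) = j := by
        simp [hfound, InjOn]
      have hsucc (i : Fin n) : (InjOn s (Iic i.succ) ∧
          (∀ k ≤ i.succ, s k ∉ B (bucketIndex m (s k))) ∧ bucketIndex m (s i.succ) = j) ↔
          InjOn (fun k => s k.succ) (Iic i) ∧ (∀ k ≤ i, s k.succ ∉
            update B (bucketIndex m (s 0)) (B (bucketIndex m (s 0)) ++ [s 0])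
              (bucketIndex m (s k.succ))) ∧ bucketIndex m (s i.succ) = j := by
        simp only [injOn_Iic_succ_iff, notMem_update_append_singleton_iff, Fin.forall_fin_succ,
          Fin.zero_le, Fin.succ_le_succ_iff, hfound, not_false_eq_true, forall_const, true_and,
          forall_and]
        tauto
      simp only [if_neg hfound, ih, length_update_append_singleton, hzero, hsucc, add_assoc]

open scoped Classical in
lemma bucketCount_eq_card (m j : ℕ) {n : ℕ} (s : Fin n → ℕ) :
    bucketCount m s j = #{i | InjOn s (Iic i) ∧ bucketIndex m (s i) = j} := by
  simp [bucketCount, length_bucketLoop_ofFn]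

lemma bucketIndex_eq_iff {m x j : ℕ} (hm : 1 ≤ m) (hj : 1 ≤ j) :
    bucketIndex m x = j ↔ x ∈ Finset.Ioc ((j - 1) * m) (j * m) := by
  have hm' : (0 : ℚ) < m := by exact_mod_cast hm
  rw [bucketIndex, Nat.ceil_eq_iff (by omega), lt_div_iff₀ hm', div_le_iff₀ hm', Finset.mem_Ioc]
  norm_cast

lemma card_Ioc_sub_one_mul_mul (m : ℕ) {j : ℕ} (hj : 1 ≤ j) :
    #(Finset.Ioc ((j - 1) * m) (j * m)) = m := by
  rw [Nat.card_Ioc, ← Nat.sub_mul, Nat.sub_sub_self hj, one_mul]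

end Algorithm

section Counting

variable {α : Type*} [DecidableEq α] {ι : Type*} [Fintype ι] [DecidableEq ι]

/-- The set of injective words over the alphabet `S` with positions indexed by `ι`. -/
def injectiveWords (ι : Type*) [Fintype ι] [DecidableEq ι] (S : Finset α) : Finset (ι → α) :=
  {f ∈ Fintype.piFinset fun _ => S | Injective f}

lemma mem_injectiveWords {S : Finset α} {f : ι → α} :
    f ∈ injectiveWords ι S ↔ (∀ i, f i ∈ S) ∧ Injective f := by
  rw [injectiveWords, Finset.mem_filter, Fintype.mem_piFinset]

lemma card_injectiveWords (S : Finset α) :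
    #(injectiveWords ι S) = (#S).descFactorial (Fintype.card ι) := by
  rw [← Fintype.card_coe S, ← Fintype.card_embedding_eq, ← Finset.card_univ]
  symm
  refine Finset.card_nbij (fun (e : ι ↪ S) i => (e i : α)) (fun e _ => ?_)
    (fun e _ e' _ h => ?_) fun f hf => ?_
  · exact mem_injectiveWords.2 ⟨fun i => (e i).2, Subtype.val_injective.comp e.injective⟩
  · ext i
    exact congrFun h i
  · obtain ⟨hS, hinj⟩ := mem_injectiveWords.1 hf
    exact ⟨⟨fun i => ⟨f i, hS i⟩, fun a b h => hinj (congrArg Subtype.val h)⟩,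
      Finset.mem_coe.2 (Finset.mem_univ _), rfl⟩

lemma swap_comp_mem_injectiveWords {S : Finset α} {x y : α} (hx : x ∈ S) (hy : y ∈ S)
    {f : ι → α} (hf : f ∈ injectiveWords ι S) :
    Equiv.swap x y ∘ f ∈ injectiveWords ι S := by
  obtain ⟨hS, hinj⟩ := mem_injectiveWords.1 hf
  refine mem_injectiveWords.2 ⟨fun i => ?_, (Equiv.injective _).comp hinj⟩
  rw [comp_apply, Equiv.swap_apply_def]
  split_ifs
  exacts [hy, hx, hS i]

lemma card_injectiveWords_filter_apply_eq {S : Finset α} (l : ι) {x y : α} (hx : x ∈ S)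
    (hy : y ∈ S) :
    #{f ∈ injectiveWords ι S | f l = x} = #{f ∈ injectiveWords ι S | f l = y} := by
  refine Finset.card_nbij' (Equiv.swap x y ∘ ·) (Equiv.swap x y ∘ ·) ?_ ?_ ?_ ?_
  all_goals
    intro f hf
    simp_all [swap_comp_mem_injectiveWords, ← comp_assoc, ← Equiv.coe_trans]

lemma card_mul_card_injectiveWords_filter_apply_mem {S T : Finset α} (hTS : T ⊆ S) (l : ι) :
    #S * #{f ∈ injectiveWords ι S | f l ∈ T} =
      #T * (#S).descFactorial (Fintype.card ι) := by
  have hS : #{f ∈ injectiveWords ι S | f l ∈ S} = #(injectiveWords ι S) :=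
    congrArg Finset.card (Finset.filter_true_of_mem fun f hf => (mem_injectiveWords.1 hf).1 l)
  calc #S * #{f ∈ injectiveWords ι S | f l ∈ T}
      = ∑ _y ∈ S, ∑ x ∈ T, #{f ∈ injectiveWords ι S | f l = x} := by
        rw [Finset.sum_card_fiberwise_eq_card_filter, Finset.sum_const, smul_eq_mul]
    _ = ∑ y ∈ S, ∑ _x ∈ T, #{f ∈ injectiveWords ι S | f l = y} :=
        Finset.sum_congr rfl fun y hy => Finset.sum_congr rfl fun x hx =>
          card_injectiveWords_filter_apply_eq l (hTS hx) hy
    _ = #T * (#S).descFactorial (Fintype.card ι) := by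
        simp only [Finset.sum_const, smul_eq_mul]
        rw [← Finset.mul_sum, Finset.sum_card_fiberwise_eq_card_filter, hS, card_injectiveWords]

end Counting

section Uniform

lemma natCast_card_filter_eq_sum_indicator {Ω ι : Type*} [Fintype ι] (p : ι → Ω → Prop)
    [∀ i ω, Decidable (p i ω)] (ω : Ω) :
    (#{i | p i ω} : ℝ) = ∑ i, {ω | p i ω}.indicator 1 ω := by
  classical
  simp only [Finset.natCast_card_filter, indicator_apply, mem_ofPred_eq, Pi.one_apply]

variable {Ω α : Type*} [MeasurableSpace Ω] {P : Measure Ω} [MeasurableSpace α] [Countable α]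
  [MeasurableSingletonClass α] {S T : Finset α}

lemma integrable_card_filter {ι : Type*} [Fintype ι] [IsFiniteMeasure P] {p : ι → Ω → Prop}
    [∀ i ω, Decidable (p i ω)] (hp : ∀ i, NullMeasurableSet {ω | p i ω} P) :
    Integrable (fun ω => (#{i | p i ω} : ℝ)) P := by
  simp only [natCast_card_filter_eq_sum_indicator]
  exact integrable_finsetSum _ fun i _ => (integrable_const 1).indicator₀ (hp i)

lemma integral_card_filter {ι : Type*} [Fintype ι] [IsFiniteMeasure P] {p : ι → Ω → Prop}
    [∀ i ω, Decidable (p i ω)] (hp : ∀ i, NullMeasurableSet {ω | p i ω} P) :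
    ∫ ω, (#{i | p i ω} : ℝ) ∂P = ∑ i, P.real {ω | p i ω} := by
  simp only [natCast_card_filter_eq_sum_indicator]
  rw [integral_finsetSum _ fun i _ => (integrable_const 1).indicator₀ (hp i)]
  simp [integral_indicator₀, hp]

lemma pi_uniformOn {ι : Type*} [Fintype ι] [DecidableEq ι] (S : ι → Finset α) :
    Measure.pi (fun i => uniformOn (S i : Set α)) =
      uniformOn (Fintype.piFinset S : Set (ι → α)) := by
  classical
  refine Measure.ext_of_singleton fun f => ?_
  have hinter : Fintype.piFinset S ∩ {f} = Fintype.piFinset fun i => S i ∩ {f i} := by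
    rw [Fintype.piFinset_inter, Fintype.piFinset_singleton]
  rw [Measure.pi_singleton, ← Finset.coe_singleton f, uniformOn_apply_finset, hinter]
  simp [← Finset.coe_singleton, uniformOn_apply_finset, ENNReal.prod_div_distrib_of_ne_top]

lemma measureReal_injective_and_apply_mem {ι : Type*} [Fintype ι] {X : ι → Ω → α}
    (hX : ∀ i, HasLaw (X i) (uniformOn (S : Set α)) P) (hi : iIndepFun X P) (hTS : T ⊆ S)
    (l : ι) :
    P.real {ω | Injective (X · ω) ∧ X l ω ∈ T} =
      #T / #S * ((#S).descFactorial (Fintype.card ι) / (#S : ℝ) ^ Fintype.card ι) := by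
  classical
  have hlaw := hi.hasLaw_pi hX
  rw [pi_uniformOn] at hlaw
  have hevent : ((Fintype.piFinset fun _ : ι => S : Finset (ι → α)) : Set (ι → α)) ∩
      {f | Injective f ∧ f l ∈ T} = ({f ∈ injectiveWords ι S | f l ∈ T} : Finset (ι → α)) := by
    ext f
    simp [mem_injectiveWords, and_assoc]
  have hcount : (#S : ℝ) * #{f ∈ injectiveWords ι S | f l ∈ T} =
      #T * (#S).descFactorial (Fintype.card ι) := by
    exact_mod_cast card_mul_card_injectiveWords_filter_apply_mem hTS l
  have hsub : {f ∈ injectiveWords ι S | f l ∈ T} ⊆ Fintype.piFinset fun _ => S :=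
    fun f hf => Fintype.mem_piFinset.2 (mem_injectiveWords.1 (Finset.mem_filter.1 hf).1).1
  calc P.real {ω | Injective (X · ω) ∧ X l ω ∈ T}
      = #{f ∈ injectiveWords ι S | f l ∈ T} / (#S : ℝ) ^ Fintype.card ι := by
        rw [hlaw.measureReal_eq (p := fun f => Injective f ∧ f l ∈ T)
          (to_countable _).measurableSet, measureReal_def,
          ← uniformOn_inter_self (Finset.finite_toSet _), hevent, uniformOn_apply_finset,
          Finset.inter_eq_right.2 hsub]
        simp
    _ = #T / #S * ((#S).descFactorial (Fintype.card ι) / (#S : ℝ) ^ Fintype.card ι) := by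
        rcases S.eq_empty_or_nonempty with rfl | hS
        · have : Nonempty ι := ⟨l⟩
          simp
        · have : (#S : ℝ) ≠ 0 := by exact_mod_cast hS.card_ne_zero
          field_simp
          linear_combination hcount

lemma nullMeasurableSet_injOn_Iic_and {n : ℕ} {X : Fin n → Ω → α} {p : α → Prop}
    (hX : ∀ i, AEMeasurable (X i) P) (i : Fin n) :
    NullMeasurableSet {ω | InjOn (X · ω) (Iic i) ∧ p (X i ω)} P :=
  (aemeasurable_pi_lambda _ hX).nullMeasurableSet_preimage
    (s := {f : Fin n → α | InjOn f (Iic i) ∧ p (f i)}) (to_countable _).measurableSet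

lemma measureReal_injOn_Iic_and_mem {n : ℕ} {X : Fin n → Ω → α}
    (hX : ∀ i, HasLaw (X i) (uniformOn (S : Set α)) P) (hi : iIndepFun X P) (hTS : T ⊆ S)
    (i : Fin n) :
    P.real {ω | InjOn (X · ω) (Iic i) ∧ X i ω ∈ T} =
      #T / #S * ((#S).descFactorial (i + 1) / (#S : ℝ) ^ (i + 1 : ℕ)) := by
  have h := measureReal_injective_and_apply_mem (fun k : Iic i => hX k)
    (hi.precomp Subtype.val_injective) hTS ⟨i, self_mem_Iic⟩
  have hcard : Fintype.card (Iic i) = i + 1 := by simp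
  rw [hcard] at h
  simp only [injOn_iff_injective]
  exact h

lemma integrable_bucketCount [IsFiniteMeasure P] (m j : ℕ) {n : ℕ} {s : Fin n → Ω → ℕ}
    (hs : ∀ i, AEMeasurable (s i) P) :
    Integrable (fun ω => (bucketCount m (s · ω) j : ℝ)) P := by
  classical
  simp only [bucketCount_eq_card]
  exact integrable_card_filter (p := fun i ω => InjOn (s · ω) (Iic i) ∧ bucketIndex m (s i ω) = j)
    fun i => nullMeasurableSet_injOn_Iic_and (p := (bucketIndex m · = j)) hs i

lemma integral_bucketCount [IsFiniteMeasure P] {m n j : ℕ} (hm : 1 ≤ m) (hj : 1 ≤ j)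
    (hjn : j * m ≤ n) {s : Fin n → Ω → ℕ}
    (hs : ∀ i, HasLaw (s i) (uniformOn (Icc 1 n)) P) (hi : iIndepFun s P) :
    ∫ ω, (bucketCount m (s · ω) j : ℝ) ∂P =
      m / n * ramanujanQ n := by
  classical
  have hbucket : Finset.Ioc ((j - 1) * m) (j * m) ⊆ Finset.Icc 1 n := fun x hx => by
    rw [Finset.mem_Ioc] at hx
    exact Finset.mem_Icc.2 ⟨by omega, hx.2.trans hjn⟩
  rw [← Finset.coe_Icc] at hs
  simp only [bucketCount_eq_card]
  rw [integral_card_filter (p := fun i ω => InjOn (s · ω) (Iic i) ∧ bucketIndex m (s i ω) = j)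
    fun i => nullMeasurableSet_injOn_Iic_and (p := (bucketIndex m · = j))
      (fun i => (hs i).aemeasurable) i]
  simp only [bucketIndex_eq_iff hm hj, measureReal_injOn_Iic_and_mem hs hi hbucket,
    card_Ioc_sub_one_mul_mul m hj, Nat.card_Icc, Nat.add_sub_cancel]
  rw [← Finset.mul_sum, ramanujanQ, Fin.sum_univ_eq_sum_range
    (fun k => (n.descFactorial (k + 1) : ℝ) / (n : ℝ) ^ (k + 1))]

end Uniform

section Ramanujan

lemma sum_Icc_mul_sub_succ {R : Type*} [CommRing R] (p : ℕ → R) (N : ℕ) :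
    ∑ k ∈ Finset.Icc 1 N, (k : R) * (p k - p (k + 1)) =
      ∑ k ∈ Finset.range N, p (k + 1) - N * p (N + 1) := by
  induction N with
  | zero => simp
  | succ N ih =>
    rw [Finset.sum_Icc_succ_top (by omega), ih, Finset.sum_range_succ]
    push_cast
    ring

lemma factorial_mul_sq_div_eq {n k : ℕ} (hn : n ≠ 0) (hk : k ≤ n) :
    ((n.factorial : ℝ) * (k : ℝ) ^ 2) / (((n - k).factorial : ℝ) * (n : ℝ) ^ (k + 1)) =
      k * ((n.descFactorial k : ℝ) / (n : ℝ) ^ k -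
        (n.descFactorial (k + 1) : ℝ) / (n : ℝ) ^ (k + 1)) := by
  have hfac : ((n - k).factorial : ℝ) ≠ 0 := by exact_mod_cast (n - k).factorial_ne_zero
  rw [← Nat.factorial_mul_descFactorial hk, Nat.descFactorial_succ]
  push_cast [hk]
  field_simp
  ring

lemma sum_factorial_mul_sq_div {n : ℕ} (hn : n ≠ 0) :
    ∑ k ∈ Finset.Icc 1 n,
      ((n.factorial : ℝ) * (k : ℝ) ^ 2) / (((n - k).factorial : ℝ) * (n : ℝ) ^ (k + 1)) =
      ramanujanQ n := by
  rw [Finset.sum_congr rfl fun k hk => factorial_mul_sq_div_eq hn (Finset.mem_Icc.1 hk).2,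
    sum_Icc_mul_sub_succ fun k => (n.descFactorial k : ℝ) / (n : ℝ) ^ k,
    Nat.descFactorial_of_lt n.lt_succ_self, Nat.cast_zero, zero_div, mul_zero, sub_zero, ramanujanQ]

lemma mu_eq_sqrt_sub_ramanujanQ_div_sqrt {n : ℕ} (hn : n ≠ 0) :
    mu n = √(π / 2) - ramanujanQ n / √n := by
  have hsqrt : √(n : ℝ) ≠ 0 := by positivity
  rw [mu, kappa, sum_factorial_mul_sq_div hn, mul_div_right_comm, sqrt_mul (by positivity)]
  field_simp
  ring

lemma integrableOn_pow_mul_exp_neg_mul {c : ℝ} (hc : 0 < c) (k : ℕ) :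
    IntegrableOn (fun x : ℝ => x ^ k * exp (-(c * x))) (Ioi 0) := by
  simpa using integrableOn_rpow_mul_exp_neg_mul_rpow (p := 1) (s := k) (b := c)
    (neg_one_lt_zero.trans_le k.cast_nonneg) one_pos hc

lemma integral_pow_mul_exp_neg_mul {c : ℝ} (hc : 0 < c) (k : ℕ) :
    ∫ x in Ioi (0 : ℝ), x ^ k * exp (-(c * x)) = k.factorial / c ^ (k + 1) := by
  have h := integral_rpow_mul_exp_neg_mul_Ioi (a := (k + 1 : ℕ)) (by positivity) hc
  rw [rpow_natCast, Nat.cast_add_one, add_sub_cancel_right, Gamma_nat_eq_factorial, one_div,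
    inv_pow, inv_mul_eq_div] at h
  simpa only [rpow_natCast] using h

lemma integral_one_add_pow_mul_exp_neg_mul {c : ℝ} (hc : 0 < c) (n : ℕ) :
    ∫ x in Ioi (0 : ℝ), (1 + x) ^ n * exp (-(c * x)) =
      ∑ k ∈ Finset.range (n + 1), (n.descFactorial k : ℝ) / c ^ (k + 1) := by
  have hexpand (x : ℝ) : (1 + x) ^ n * exp (-(c * x)) =
      ∑ k ∈ Finset.range (n + 1), (n.choose k : ℝ) * (x ^ k * exp (-(c * x))) := by
    rw [add_comm, add_pow, Finset.sum_mul]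
    exact Finset.sum_congr rfl fun k _ => by ring
  simp only [hexpand]
  rw [integral_finsetSum _ fun k _ => (integrableOn_pow_mul_exp_neg_mul hc k).const_mul _]
  refine Finset.sum_congr rfl fun k _ => ?_
  rw [integral_const_mul, integral_pow_mul_exp_neg_mul hc,
    Nat.descFactorial_eq_factorial_mul_choose]
  push_cast
  ring

lemma ramanujanQ_succ_eq_integral (n : ℕ) :
    ramanujanQ (n + 1) =
      (n + 1) * ∫ x in Ioi (0 : ℝ), (1 + x) ^ n * exp (-((n + 1) * x)) := by
  rw [integral_one_add_pow_mul_exp_neg_mul (by positivity), ramanujanQ, Finset.mul_sum]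
  refine Finset.sum_congr rfl fun k _ => ?_
  rw [Nat.succ_descFactorial_succ]
  push_cast
  ring

end Ramanujan

section Saddle

/-- The substitution `t = √(2 (x - log (1 + x)))`, for which
`exp (-(a / 2) t²) = (1 + x) ^ a exp (-(a x))`. -/
noncomputable def saddle (x : ℝ) : ℝ := √(2 * (x - log (1 + x)))

lemma log_one_add_lt {x : ℝ} (hx : 0 < x) : log (1 + x) < ((1 + x) - (1 + x)⁻¹) / 2 := by
  rw [← sinh_log (by positivity)]
  exact self_lt_sinh_iff.2 (log_pos (by linarith))

lemma sq_div_one_add_lt {x : ℝ} (hx : 0 < x) :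
    x ^ 2 / (1 + x) < 2 * (x - log (1 + x)) := by
  have hsplit : x ^ 2 / (1 + x) = 2 * (x - ((1 + x) - (1 + x)⁻¹) / 2) := by
    field_simp
    ring
  linarith [log_one_add_lt hx]

lemma two_mul_sub_log_one_add_pos {x : ℝ} (hx : 0 < x) : 0 < 2 * (x - log (1 + x)) :=
  (by positivity : 0 < x ^ 2 / (1 + x)).trans (sq_div_one_add_lt hx)

lemma saddle_zero : saddle 0 = 0 := by simp [saddle]

lemma saddle_pos {x : ℝ} (hx : 0 < x) : 0 < saddle x :=
  sqrt_pos.2 (two_mul_sub_log_one_add_pos hx)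

lemma saddle_sq {x : ℝ} (hx : 0 < x) : saddle x ^ 2 = 2 * (x - log (1 + x)) :=
  sq_sqrt (two_mul_sub_log_one_add_pos hx).le

lemma sq_lt_saddle_sq_mul {x : ℝ} (hx : 0 < x) : x ^ 2 < saddle x ^ 2 * (1 + x) := by
  rw [saddle_sq hx, ← div_lt_iff₀ (by positivity)]
  exact sq_div_one_add_lt hx

lemma saddle_le {x : ℝ} (hx : 0 ≤ x) : saddle x ≤ x := by
  refine sqrt_le_iff.2 ⟨hx, ?_⟩
  calc 2 * (x - log (1 + x)) ≤ 2 * (x - 2 * x / (x + 2)) := by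
        linarith [le_log_one_add_of_nonneg hx]
    _ = x ^ 2 * (2 / (x + 2)) := by
        field_simp
        ring
    _ ≤ x ^ 2 := mul_le_of_le_one_right (sq_nonneg x)
        ((div_le_one (by positivity)).2 (by linarith))

lemma exp_neg_half_mul_saddle_sq (a : ℝ) {x : ℝ} (hx : 0 < x) :
    exp (-(a / 2) * saddle x ^ 2) = (1 + x) ^ a * exp (-(a * x)) := by
  rw [saddle_sq hx, rpow_def_of_pos (by positivity), ← exp_add]
  ring_nf

lemma hasDerivAt_saddle {x : ℝ} (hx : 0 < x) :
    HasDerivAt saddle (x / ((1 + x) * saddle x)) x := by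
  have hlog := ((hasDerivAt_id' x).const_add 1).log (by positivity)
  refine ((((hasDerivAt_id' x).fun_sub hlog).const_mul 2).sqrt
    (two_mul_sub_log_one_add_pos hx).ne').congr_deriv ?_
  have hsaddle := (saddle_pos hx).ne'
  change _ / (2 * saddle x) = x / ((1 + x) * saddle x)
  field_simp
  ring

lemma continuousOn_saddle : ContinuousOn saddle (Ici 0) := by
  have hlog : ContinuousOn (fun x : ℝ => log (1 + x)) (Ici 0) :=
    ContinuousOn.log (by fun_prop) fun x (hx : 0 ≤ x) => by positivity
  unfold saddle
  fun_prop

lemma strictMonoOn_saddle : StrictMonoOn saddle (Ici 0) := by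
  refine strictMonoOn_of_deriv_pos (convex_Ici 0) continuousOn_saddle fun x hx => ?_
  rw [interior_Ici, mem_Ioi] at hx
  rw [(hasDerivAt_saddle hx).deriv]
  have hsaddle := saddle_pos hx
  positivity

lemma tendsto_saddle_atTop : Tendsto saddle atTop atTop := by
  have hsqrt : Tendsto (fun x : ℝ => √(x - 1)) atTop atTop :=
    tendsto_sqrt_atTop.comp (tendsto_atTop_add_const_right _ (-1) tendsto_id)
  refine tendsto_atTop_mono' _ ?_ hsqrt
  filter_upwards [eventually_gt_atTop 0] with x hx
  refine sqrt_le_sqrt (le_trans ?_ (sq_div_one_add_lt hx).le)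
  rw [le_div_iff₀ (by positivity)]
  linarith [sq_nonneg x]

lemma bijOn_saddle : BijOn saddle (Ioi 0) (Ioi 0) := by
  have himage := continuousOn_saddle.image_Ioi_of_strictMonoOn strictMonoOn_saddle
    tendsto_saddle_atTop
  rw [saddle_zero] at himage
  exact ⟨fun x hx => saddle_pos hx, strictMonoOn_saddle.injOn.mono Ioi_subset_Ici_self,
    himage.ge⟩

lemma strictAntiOn_saddle_div : StrictAntiOn (fun x => saddle x / x) (Ioi 0) := by
  have hderiv (x : ℝ) (hx : 0 < x) : HasDerivAt (fun x => saddle x / x)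
      ((x / ((1 + x) * saddle x) * x - saddle x * 1) / x ^ 2) x :=
    (hasDerivAt_saddle hx).div (hasDerivAt_id x) hx.ne'
  refine strictAntiOn_of_deriv_neg (convex_Ioi 0)
    (fun y hy => (hderiv y hy).continuousAt.continuousWithinAt) fun x hx => ?_
  rw [interior_Ioi, mem_Ioi] at hx
  rw [(hderiv x hx).deriv]
  have hsaddle := saddle_pos hx
  refine div_neg_of_neg_of_pos ?_ (by positivity)
  rw [div_mul_eq_mul_div, sub_neg, div_lt_iff₀ (by positivity)]
  linarith [sq_lt_saddle_sq_mul hx]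

/-- The inverse of `saddle` on the positive half-line; its values outside are irrelevant. -/
noncomputable def saddleInv : ℝ → ℝ := invFunOn saddle (Ioi 0)

lemma invOn_saddleInv : InvOn saddleInv saddle (Ioi 0) (Ioi 0) :=
  bijOn_saddle.invOn_invFunOn

lemma saddleInv_pos {t : ℝ} (ht : 0 < t) : 0 < saddleInv t :=
  bijOn_saddle.surjOn.mapsTo_invFunOn ht

lemma saddle_saddleInv {t : ℝ} (ht : 0 < t) : saddle (saddleInv t) = t :=
  invOn_saddleInv.2 ht

lemma strictMonoOn_saddleInv : StrictMonoOn saddleInv (Ioi 0) := by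
  intro a ha b hb hab
  rwa [← strictMonoOn_saddle.lt_iff_lt (saddleInv_pos ha).le (saddleInv_pos hb).le,
    saddle_saddleInv ha, saddle_saddleInv hb]

/-- The factor `t / x` of the Jacobian `dx / (1 + x) = (t / x) dt` of the substitution
`t = saddle x`, as a function of `t`. -/
noncomputable def saddleRatio (t : ℝ) : ℝ := t / saddleInv t

lemma saddleRatio_saddle {x : ℝ} (hx : 0 < x) : saddleRatio (saddle x) = saddle x / x := by
  rw [saddleRatio, invOn_saddleInv.1 hx]

lemma strictAntiOn_saddleRatio : StrictAntiOn saddleRatio (Ioi 0) := by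
  intro a ha b hb hab
  simpa only [saddleRatio, saddle_saddleInv ha, saddle_saddleInv hb] using
    strictAntiOn_saddle_div (saddleInv_pos ha) (saddleInv_pos hb)
      (strictMonoOn_saddleInv ha hb hab)

lemma saddleRatio_pos {t : ℝ} (ht : 0 < t) : 0 < saddleRatio t := div_pos ht (saddleInv_pos ht)

lemma saddleRatio_le_one {t : ℝ} (ht : 0 < t) : saddleRatio t ≤ 1 := by
  refine (div_le_one (saddleInv_pos ht)).2 ?_
  simpa only [saddle_saddleInv ht] using saddle_le (saddleInv_pos ht).le

lemma norm_saddleRatio_le_one {t : ℝ} (ht : 0 < t) : ‖saddleRatio t‖ ≤ 1 := by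
  rw [norm_of_nonneg (saddleRatio_pos ht).le]
  exact saddleRatio_le_one ht

lemma one_sub_le_saddleRatio {t : ℝ} (ht : 0 < t) : 1 - t ≤ saddleRatio t := by
  have hx := saddleInv_pos ht
  have hsq := sq_lt_saddle_sq_mul hx
  have hle := saddle_le hx.le
  rw [saddle_saddleInv ht] at hsq hle
  rw [saddleRatio, le_div_iff₀ hx]
  by_contra! hlt
  refine hsq.not_ge ?_
  calc t ^ 2 * (1 + saddleInv t) = t * (t * (1 + saddleInv t)) := by ring
    _ ≤ saddleInv t * saddleInv t := mul_le_mul hle (by linarith) (by positivity) hx.le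
    _ = saddleInv t ^ 2 := (sq _).symm

lemma tendsto_saddleRatio_nhdsGT_zero : Tendsto saddleRatio (𝓝[>] 0) (𝓝 1) := by
  have hlower : Tendsto (fun t : ℝ => 1 - t) (𝓝[>] 0) (𝓝 1) :=
    ((continuous_sub_left (1 : ℝ)).tendsto' 0 1 (sub_zero 1)).mono_left nhdsWithin_le_nhds
  refine tendsto_of_tendsto_of_tendsto_of_le_of_le' hlower tendsto_const_nhds ?_ ?_
  · filter_upwards [self_mem_nhdsWithin] with t ht using one_sub_le_saddleRatio ht
  · filter_upwards [self_mem_nhdsWithin] with t ht using saddleRatio_le_one ht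

lemma integral_mul_saddleRatio (f : ℝ → ℝ) :
    ∫ t in Ioi (0 : ℝ), f t * saddleRatio t = ∫ x in Ioi (0 : ℝ), f (saddle x) / (1 + x) := by
  rw [← bijOn_saddle.image_eq, integral_image_eq_integral_abs_deriv_smul measurableSet_Ioi
    (fun x hx => (hasDerivAt_saddle hx).hasDerivWithinAt) bijOn_saddle.injOn,
    bijOn_saddle.image_eq]
  refine setIntegral_congr_fun measurableSet_Ioi fun x (hx : 0 < x) => ?_
  have hsaddle := saddle_pos hx
  simp only [smul_eq_mul]
  rw [abs_of_pos (by positivity), saddleRatio_saddle hx]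
  field_simp

end Saddle

section Dilation

lemma setIntegral_lt_setIntegral_of_lt {α : Type*} [MeasurableSpace α] {ν : Measure α} {S : Set α}
    {f g : α → ℝ} (hf : IntegrableOn f S ν) (hg : IntegrableOn g S ν) (hS : MeasurableSet S)
    (hν : ν S ≠ 0) (hlt : ∀ x ∈ S, f x < g x) :
    ∫ x in S, f x ∂ν < ∫ x in S, g x ∂ν := by
  have hpos (x : α) (hx : x ∈ S) : 0 < g x - f x := sub_pos.2 (hlt x hx)
  rw [← sub_pos, ← integral_sub hg hf, setIntegral_pos_iff_support_of_nonneg_ae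
    ((ae_restrict_mem hS).mono fun x hx => (hpos x hx).le) (hg.sub hf)]
  exact hν.bot_lt.trans_le (measure_mono fun x hx => ⟨(hpos x hx).ne', hx⟩)

variable {w ρ : ℝ → ℝ} {C : ℝ}

lemma integrableOn_mul_comp_div (hw : IntegrableOn w (Ioi 0)) (hρ : AntitoneOn ρ (Ioi 0))
    (hC : ∀ t, 0 < t → ‖ρ t‖ ≤ C) {c : ℝ} (hc : 0 < c) :
    IntegrableOn (fun s => w s * ρ (s / c)) (Ioi 0) := by
  have hanti : AntitoneOn (fun s => ρ (s / c)) (Ioi 0) := fun a ha b hb hab =>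
    hρ (div_pos ha hc) (div_pos hb hc) (div_le_div_of_nonneg_right hab hc.le)
  refine hw.mul_bdd (c := C)
    (aemeasurable_restrict_of_antitoneOn measurableSet_Ioi hanti).aestronglyMeasurable ?_
  filter_upwards [ae_restrict_mem measurableSet_Ioi] with s hs using hC _ (div_pos hs hc)

lemma strictMonoOn_integral_mul_comp_div (hw : IntegrableOn w (Ioi 0))
    (hw_pos : ∀ s, 0 < s → 0 < w s) (hρ : StrictAntiOn ρ (Ioi 0))
    (hC : ∀ t, 0 < t → ‖ρ t‖ ≤ C) :
    StrictMonoOn (fun c => ∫ s in Ioi 0, w s * ρ (s / c)) (Ioi 0) := by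
  intro c (hc : 0 < c) d (hd : 0 < d) hcd
  refine setIntegral_lt_setIntegral_of_lt (integrableOn_mul_comp_div hw hρ.antitoneOn hC hc)
    (integrableOn_mul_comp_div hw hρ.antitoneOn hC hd) measurableSet_Ioi (by simp)
    fun s (hs : 0 < s) => ?_
  exact mul_lt_mul_of_pos_left
    (hρ (div_pos hs hd) (div_pos hs hc) (div_lt_div_of_pos_left hs hc hcd)) (hw_pos s hs)

lemma tendsto_integral_mul_comp_div_atTop (hw : IntegrableOn w (Ioi 0))
    (hρ : AntitoneOn ρ (Ioi 0)) (hC : ∀ t, 0 < t → ‖ρ t‖ ≤ C) {l : ℝ}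
    (hl : Tendsto ρ (𝓝[>] 0) (𝓝 l)) :
    Tendsto (fun c => ∫ s in Ioi 0, w s * ρ (s / c)) atTop (𝓝 ((∫ s in Ioi 0, w s) * l)) := by
  rw [← integral_mul_const]
  refine tendsto_integral_filter_of_dominated_convergence (fun s => ‖w s‖ * C) ?_ ?_
    (hw.norm.mul_const C) ?_
  · filter_upwards [eventually_gt_atTop 0] with c hc
    exact (integrableOn_mul_comp_div hw hρ hC hc).aestronglyMeasurable
  · filter_upwards [eventually_gt_atTop 0] with c hc
    filter_upwards [ae_restrict_mem measurableSet_Ioi] with s hs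
    rw [norm_mul]
    exact mul_le_mul_of_nonneg_left (hC _ (div_pos hs hc)) (norm_nonneg _)
  · filter_upwards [ae_restrict_mem measurableSet_Ioi] with s hs
    refine (hl.comp ?_).const_mul (w s)
    refine tendsto_nhdsWithin_iff.2 ⟨tendsto_const_nhds.div_atTop tendsto_id, ?_⟩
    filter_upwards [eventually_gt_atTop 0] with c hc using div_pos hs hc

lemma integral_mul_comp_div_eq (w ρ : ℝ → ℝ) {c : ℝ} (hc : 0 < c) :
    ∫ s in Ioi 0, w s * ρ (s / c) = c * ∫ t in Ioi 0, w (c * t) * ρ t := by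
  have hscale := integral_comp_mul_left_Ioi (fun s => w s * ρ (s / c)) 0 hc
  simp only [mul_zero, mul_div_cancel_left₀ _ hc.ne', smul_eq_mul] at hscale
  rw [hscale, mul_inv_cancel_left₀ hc.ne']

end Dilation

section SaddleMean

/-- The integral of `saddleRatio`, dilated by `c`, against the Gaussian weight on the half-line;
Ramanujan's function is `Q(n) = √n * saddleMean √n`. -/
noncomputable def saddleMean (c : ℝ) : ℝ :=
  ∫ s in Ioi (0 : ℝ), exp (-(1 / 2) * s ^ 2) * saddleRatio (s / c)

lemma integrableOn_exp_neg_half_sq :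
    IntegrableOn (fun s : ℝ => exp (-(1 / 2) * s ^ 2)) (Ioi 0) :=
  (integrable_exp_neg_mul_sq (by norm_num)).integrableOn

lemma integral_exp_neg_half_sq :
    ∫ s in Ioi (0 : ℝ), exp (-(1 / 2) * s ^ 2) = √(π / 2) := by
  rw [integral_gaussian_Ioi, show π / (1 / 2) = π / 2 * 2 ^ 2 by ring,
    sqrt_mul (by positivity), sqrt_sq (by norm_num), mul_div_cancel_right₀ _ two_ne_zero]

lemma strictMonoOn_saddleMean : StrictMonoOn saddleMean (Ioi 0) :=
  strictMonoOn_integral_mul_comp_div integrableOn_exp_neg_half_sq (fun _ _ => exp_pos _)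
    strictAntiOn_saddleRatio fun _ => norm_saddleRatio_le_one

lemma tendsto_saddleMean_atTop : Tendsto saddleMean atTop (𝓝 √(π / 2)) := by
  have hlim := tendsto_integral_mul_comp_div_atTop integrableOn_exp_neg_half_sq
    strictAntiOn_saddleRatio.antitoneOn (fun _ => norm_saddleRatio_le_one)
    tendsto_saddleRatio_nhdsGT_zero
  rwa [integral_exp_neg_half_sq, mul_one] at hlim

lemma saddleMean_eq_integral {c : ℝ} (hc : 0 < c) :
    saddleMean c = c * ∫ x in Ioi (0 : ℝ), (1 + x) ^ (c ^ 2 - 1) * exp (-(c ^ 2 * x)) := by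
  rw [saddleMean, integral_mul_comp_div_eq (fun s => exp (-(1 / 2) * s ^ 2)) _ hc,
    integral_mul_saddleRatio]
  congr 1
  refine setIntegral_congr_fun measurableSet_Ioi fun x (hx : 0 < x) => ?_
  have hexponent : -(1 / 2) * (c * saddle x) ^ 2 = -(c ^ 2 / 2) * saddle x ^ 2 := by ring
  simp only [hexponent, exp_neg_half_mul_saddle_sq _ hx, rpow_sub_one (by positivity : 1 + x ≠ 0)]
  ring

lemma ramanujanQ_div_sqrt {n : ℕ} (hn : n ≠ 0) : ramanujanQ n / √n = saddleMean √n := by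
  obtain ⟨N, rfl⟩ := Nat.exists_eq_succ_of_ne_zero hn
  have hsqrt : 0 < √(N.succ : ℝ) := by positivity
  rw [saddleMean_eq_integral hsqrt, sq_sqrt (Nat.cast_nonneg _), Nat.cast_succ,
    add_sub_cancel_right, ramanujanQ_succ_eq_integral, mul_div_right_comm, div_sqrt]
  simp only [rpow_natCast]

lemma mu_eq_sqrt_sub_saddleMean {n : ℕ} (hn : n ≠ 0) : mu n = √(π / 2) - saddleMean √n := by
  rw [mu_eq_sqrt_sub_ramanujanQ_div_sqrt hn, ramanujanQ_div_sqrt hn]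

lemma strictAntiOn_mu : StrictAntiOn mu (Ici 1) := by
  intro a (ha : 1 ≤ a) b (hb : 1 ≤ b) hab
  rw [mu_eq_sqrt_sub_saddleMean (by omega), mu_eq_sqrt_sub_saddleMean (by omega)]
  refine sub_lt_sub_left (strictMonoOn_saddleMean ?_ ?_ (sqrt_lt_sqrt a.cast_nonneg ?_)) _
  · exact sqrt_pos.2 (by exact_mod_cast ha)
  · exact sqrt_pos.2 (by exact_mod_cast hb)
  · exact_mod_cast hab

lemma tendsto_mu_atTop : Tendsto mu atTop (𝓝 0) := by
  have hlim : Tendsto (fun n : ℕ => √(π / 2) - saddleMean √n) atTop (𝓝 (√(π / 2) - √(π / 2))) :=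
    (tendsto_saddleMean_atTop.comp
      (tendsto_sqrt_atTop.comp tendsto_natCast_atTop_atTop)).const_sub _
  rw [sub_self] at hlim
  refine hlim.congr' ?_
  filter_upwards [eventually_ne_atTop 0] with n hn using (mu_eq_sqrt_sub_saddleMean hn).symm

end SaddleMean

end BucketTest

theorem lemma14_general :
    (∀ {Ω : Type*} [MeasurableSpace Ω] (P : MeasureTheory.Measure Ω)
        [MeasureTheory.IsProbabilityMeasure P] (m n : ℕ), 1 ≤ m →
      ∀ s : Fin n → Ω → ℕ,
        (∀ i, ProbabilityTheory.HasLaw (s i) (ProbabilityTheory.uniformOn (Set.Icc 1 n)) P) →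
        ProbabilityTheory.iIndepFun s P →
        ∀ j, 1 ≤ j → j * m ≤ n →
          MeasureTheory.Integrable
            (fun ω => (BucketTest.bucketCount m (fun i => s i ω) j : ℝ)) P ∧
          ∫ ω, (BucketTest.bucketCount m (fun i => s i ω) j : ℝ) ∂P
            = m / Real.sqrt n * (Real.sqrt (Real.pi / 2) - BucketTest.mu n)) ∧
    StrictAntiOn BucketTest.mu (Set.Ici 1) ∧
    Filter.Tendsto BucketTest.mu Filter.atTop (nhds 0) := by
  refine ⟨?_, BucketTest.strictAntiOn_mu, BucketTest.tendsto_mu_atTop⟩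
  intro Ω _ P _ m n hm s hs hi j hj hjn
  have hn : n ≠ 0 := ((Nat.mul_pos hj hm).trans_le hjn).ne'
  refine ⟨BucketTest.integrable_bucketCount m j fun i => (hs i).aemeasurable, ?_⟩
  rw [BucketTest.integral_bucketCount hm hj hjn hs hi,
    BucketTest.mu_eq_sqrt_sub_ramanujanQ_div_sqrt hn, sub_sub_cancel, div_mul_div_comm,
    Real.mul_self_sqrt n.cast_nonneg, mul_div_right_comm]

theorem lemma14 :
    (∀ {Ω : Type*} [MeasurableSpace Ω] (P : MeasureTheory.Measure Ω)
        [MeasureTheory.IsProbabilityMeasure P] (m n : ℕ), 1 ≤ m → n = m ^ 2 →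
      ∀ s : Fin n → Ω → ℕ,
        (∀ i, ProbabilityTheory.HasLaw (s i) (ProbabilityTheory.uniformOn (Set.Icc 1 n)) P) →
        ProbabilityTheory.iIndepFun s P →
        ∀ j ∈ Finset.Icc 1 m,
          MeasureTheory.Integrable
            (fun ω => (BucketTest.bucketCount m (fun i => s i ω) j : ℝ)) P ∧
          ∫ ω, (BucketTest.bucketCount m (fun i => s i ω) j : ℝ) ∂P
            = Real.sqrt (Real.pi / 2) - BucketTest.mu n) ∧
    StrictAntiOn BucketTest.mu (Set.Ici 1) ∧
    Filter.Tendsto BucketTest.mu Filter.atTop (nhds 0) := by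
  refine ⟨fun P _ m n hm hn s hs hi j hj => ?_, lemma14_general.{0}.2⟩
  have hscale : (m : ℝ) / Real.sqrt n = 1 := by
    rw [hn, Nat.cast_pow, Real.sqrt_sq m.cast_nonneg, div_self (Nat.cast_ne_zero.2 (by omega))]
  have hjn : j * m ≤ n := by
    rw [hn, sq]
    exact Nat.mul_le_mul_right m (Finset.mem_Icc.1 hj).2
  simpa only [hscale, one_mul] using
    lemma14_general.1 P m n hm s hs hi j (Finset.mem_Icc.1 hj).1 hjn
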